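/- **Theorem 1.2.** Let $d\ge 1$ and let $D\subseteq\mathbb{R}^d$ be a domain (a nonempty connected open set) of finite Lebesgue measure. For $0<\alpha\le 2$ let $$\mathcal{E}_\alpha(u,v)=\int_{\mathbb{R}^d}|2\pi\xi|^{\alpha}\,\overline{\hat u(\xi)}\,\hat v(\xi)\,d\xi,\qquad \hat u(\xi)=\int_{\mathbb{R}^d} e^{-2\pi i x\cdot\xi}u(x)\,dx,$$ be the Dirichlet form of the symmetric $\alpha$-stable process on $\mathbb{R}^d$ with characteristic function $e^{-t|z|^\alpha}$ (generator $-(-\Delta)^{\alpha/2}$), defined for all $u,v\in\mathcal F_\alpha=\{u\in L^2(\mathbb{R}^d):\mathcal{E}_\alpha(u,u)<\infty\}$. Let $\mathcal{F}_{\alpha,D}$ be the closure of $C_c^\infty(D)$ in $\mathcal F_\alpha$ with respect to the norm $(\mathcal{E}_\alpha(u,u)+\|u\|_2^2)^{1/2}$, and let $H_\alpha$ be the non-negative self-adjoint operator in $L^2(D)$ associated with the closed form $(\mathcal{E}_\alpha,\mathcal{F}_{\alpha,D})$, that is, the operator of the process killed upon leaving $D$: $u\in\mathrm{Dom}(H_\alpha)$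 and $H_\alpha u=f$ if and only if $u\in\mathcal{F}_{\alpha,D}$, $f\in L^2(D)$ and $\mathcal{E}_\alpha(v,u)=\langle v,f\rangle$ for all $v\in\mathcal{F}_{\alpha,D}$. For $\alpha=2$ it is the Dirichlet Laplacian $-\Delta$ on $D$. Let $$\lambda_1^\alpha(D)\le\lambda_2^\alpha(D)\le\lambda_3^\alpha(D)\le\cdots$$ be the eigenvalues of $H_\alpha$ in nondecreasing order, repeated according to multiplicity. If $0<\alpha<\beta\le 2$, then for every integer $i\ge 1$ the $i$-th eigenvalues $\lambda_i^\alpha(D)$ and $\lambda_i^\beta(D)$ exist, and $$\big[\lambda_i^\alpha(D)\big]^{1/\alpha}\le\big[\lambda_i^\beta(D)\big]^{1/\beta}.$$ -/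

import Mathlib

open MeasureTheory FourierTransform
open scoped ContDiff

namespace StableEig

/-- The complex Hilbert space `L²(ℝᵈ)` of Lebesgue square integrable functions. -/
abbrev L2 (d : ℕ) : Type :=
  Lp (α := EuclideanSpace ℝ (Fin d)) ℂ 2 (volume : Measure (EuclideanSpace ℝ (Fin d)))

/-- The symbol of `(-Δ)^{α/2}`, that is, the characteristic exponent `|z|^α` of the symmetric
`α`-stable process, at `z = 2πξ`. The factor `2π` is there because Mathlib's Fourier transform
is `∫ exp(-2πi x·ξ) u(x) dx`. -/
noncomputable def stableSymbol {d : ℕ} (α : ℝ) (ξ : EuclideanSpace ℝ (Fin d)) : ℝ :=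
  (2 * Real.pi * ‖ξ‖) ^ α

/-- The energy `ℰ_α(u,u) = ∫ |2πξ|^α |û(ξ)|² dξ ∈ [0,∞]`, where `û` is the (Plancherel) Fourier
transform of `u ∈ L²(ℝᵈ)`. -/
noncomputable def energy {d : ℕ} (α : ℝ) (u : L2 d) : ENNReal :=
  ∫⁻ ξ, ENNReal.ofReal (stableSymbol α ξ) * ‖(𝓕 u : L2 d) ξ‖ₑ ^ 2

/-- The domain `ℱ_α` of the Dirichlet form of the symmetric `α`-stable process on `ℝᵈ`. -/
def formDomain (d : ℕ) (α : ℝ) : Set (L2 d) :=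
  {u | energy α u < ⊤}

/-- The Dirichlet form `ℰ_α(u,v) = ∫ |2πξ|^α conj(û(ξ)) v̂(ξ) dξ` of the symmetric `α`-stable
process on `ℝᵈ`; the integral converges absolutely for `u, v ∈ ℱ_α`. It is conjugate-linear
in the first variable, as is Mathlib's inner product. -/
noncomputable def dirichletForm {d : ℕ} (α : ℝ) (u v : L2 d) : ℂ :=
  ∫ ξ, (stableSymbol α ξ : ℂ) * inner ℂ ((𝓕 u : L2 d) ξ) ((𝓕 v : L2 d) ξ)

/-- (The classes of) the functions in `C_c^∞(D)`, extended by zero to `ℝᵈ`. -/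
def testFunctions {d : ℕ} (D : Set (EuclideanSpace ℝ (Fin d))) : Set (L2 d) :=
  {g | ∃ φ : EuclideanSpace ℝ (Fin d) → ℂ,
    ContDiff ℝ ∞ φ ∧ HasCompactSupport φ ∧ tsupport φ ⊆ D ∧ g =ᵐ[volume] φ}

/-- The form domain `ℱ_{α,D}` of the process killed upon leaving `D`: the closure of `C_c^∞(D)`
in `ℱ_α` with respect to the norm `(ℰ_α(u,u) + ‖u‖²)^{1/2}`. -/
def killedFormDomain {d : ℕ} (α : ℝ) (D : Set (EuclideanSpace ℝ (Fin d))) : Set (L2 d) :=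
  {u | u ∈ formDomain d α ∧
    ∀ ε : ENNReal, 0 < ε → ∃ φ ∈ testFunctions D, energy α (u - φ) + ‖u - φ‖ₑ ^ 2 < ε}

/-- The graph of the operator `H_α` of the killed process, that is, of the operator in `L²(D)`
(realized as the functions in `L²(ℝᵈ)` that vanish a.e. outside `D`) associated with the closed
form `(ℰ_α, ℱ_{α,D})`: `u ∈ Dom(H_α)` and `H_α u = f` if and only if `u ∈ ℱ_{α,D}`, `f ∈ L²(D)`
and `ℰ_α(v,u) = ⟨v,f⟩` for all `v ∈ ℱ_{α,D}`. For `α = 2` this is the Dirichlet Laplacian. -/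
def generatorGraph {d : ℕ} (α : ℝ) (D : Set (EuclideanSpace ℝ (Fin d))) : Set (L2 d × L2 d) :=
  {p | p.1 ∈ killedFormDomain α D ∧ (∀ᵐ x ∂volume, x ∉ D → p.2 x = 0) ∧
    ∀ v ∈ killedFormDomain α D, dirichletForm α v p.1 = inner ℂ v p.2}

/-- `u` is an eigenfunction of `H_α` with eigenvalue `μ`. -/
def IsEigenfunction {d : ℕ} (α : ℝ) (D : Set (EuclideanSpace ℝ (Fin d))) (μ : ℝ) (u : L2 d) :
    Prop :=
  u ≠ 0 ∧ (u, (μ : ℂ) • u) ∈ generatorGraph α D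

/-- The set of levels `t` such that `H_α` has at least `i` eigenvalues `≤ t`, counted with
multiplicity: there are `i` linearly independent eigenfunctions with eigenvalues `≤ t`. -/
def levels {d : ℕ} (α : ℝ) (D : Set (EuclideanSpace ℝ (Fin d))) (i : ℕ) : Set ℝ :=
  {t | ∃ u : Fin i → L2 d, LinearIndependent ℂ u ∧
    ∀ j, ∃ μ : ℝ, μ ≤ t ∧ IsEigenfunction α D μ (u j)}

/-- The `i`-th eigenvalue `λ_i^α(D)` (`i = 1, 2, …`) of `H_α`, the eigenvalues being listed in
nondecreasing order and repeated according to multiplicity: the least level up to which there are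
at least `i` eigenvalues. -/
noncomputable def stableEigenvalue {d : ℕ} (α : ℝ) (D : Set (EuclideanSpace ℝ (Fin d)))
    (i : ℕ) : ℝ :=
  sInf (levels α D i)

end StableEig

/-! For each `u`, write `|2πξ|^α |û|² = (|2πξ|^β |û|²)^(α/β) (|û|²)^(1-α/β)`. Hölder's inequality
then bounds the Rayleigh quotient of order `α` by the power `α/β` of the one of order `β`
(`energy_le_rpow_mul_rpow`). The form domain of order `β` lies in that of order `α`
(`killedFormDomain_anti`), so an `i`-dimensional trial space on which the `β`-quotient is at most
`b` is also one on which the `α`-quotient is at most `b^(α/β)`. The min-max principle gives the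
inequality.

Min-max requires discrete spectrum. A form is encoded by a closed subspace `Γ` of `H × K`, with
`‖p.2‖²` the energy of `p.1`; if the embedding `p ↦ p.1` is compact and its image is
infinite-dimensional, successive minimization produces the eigenvalues (`exists_isLeast_levels`).
Here `p.2 = |2πξ|^(α/2) û`, and compactness holds because `D` has finite measure: energy controls
high frequencies, while at each low frequency the Fourier transform is a bounded functional, so weak
convergence suffices (`compactEmbedding_formGraph`). -/

namespace FormGraph

/-! ### Abstract closed forms: minimizers of the Rayleigh quotient -/

open Filter Topology

variable {H K : Type*} [NormedAddCommGroup H] [InnerProductSpace ℂ H]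
  [NormedAddCommGroup K] [InnerProductSpace ℂ K]

/-- `p` is an eigenvector, with eigenvalue `μ`, of the operator of the quadratic form
`‖p.2‖ ^ 2` whose domain is `Γ`, relative to `‖p.1‖ ^ 2`. -/
def IsEigenpair (Γ : Submodule ℂ (H × K)) (μ : ℝ) (p : H × K) : Prop :=
  p ∈ Γ ∧ ∀ q ∈ Γ, inner ℂ q.2 p.2 = (μ : ℂ) * inner ℂ q.1 p.1

/-- Sequences in `Γ` that are bounded in the form norm have subsequences whose first components
converge. -/
def CompactEmbedding (Γ : Submodule ℂ (H × K)) : Prop :=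
  ∀ p : ℕ → H × K, (∀ n, p n ∈ Γ) → (∃ C : ℝ, ∀ n, ‖(p n).1‖ ≤ C ∧ ‖(p n).2‖ ≤ C) →
    ∃ φ : ℕ → ℕ, StrictMono φ ∧ ∃ h : H, Tendsto (fun n => (p (φ n)).1) atTop (𝓝 h)

/-- Direct method: compactness makes the first components of a minimizing sequence converge along a
subsequence, the parallelogram law then makes the second components Cauchy, and closedness keeps the
limit in `Γ`. -/
theorem exists_minimizer [CompleteSpace K] {Γ : Submodule ℂ (H × K)}
    (hcl : IsClosed (Γ : Set (H × K))) (hcp : CompactEmbedding Γ) (hne : ∃ p ∈ Γ, p.1 ≠ 0) :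
    ∃ p ∈ Γ, ‖p.1‖ = 1 ∧ ∀ q ∈ Γ, ‖p.2‖ ^ 2 * ‖q.1‖ ^ 2 ≤ ‖q.2‖ ^ 2 := by
  set S : Set ℝ := {x | ∃ p ∈ Γ, ‖p.1‖ = 1 ∧ ‖p.2‖ ^ 2 = x} with hS
  have hnorm : ∀ q ∈ Γ, q.1 ≠ 0 → ∃ p ∈ Γ, ‖p.1‖ = 1 ∧ ‖p.2‖ * ‖q.1‖ = ‖q.2‖ := by
    intro q hq hq0
    have h0 : ‖q.1‖ ≠ 0 := norm_ne_zero_iff.2 hq0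
    refine ⟨((‖q.1‖⁻¹ : ℝ) : ℂ) • q, Γ.smul_mem _ hq, ?_, ?_⟩
    · simp [norm_smul, h0]
    · simp [norm_smul]; field_simp
  have hSne : S.Nonempty := by
    obtain ⟨q, hq, hq0⟩ := hne
    obtain ⟨p, hp, h1, -⟩ := hnorm q hq hq0
    exact ⟨_, p, hp, h1, rfl⟩
  have hSbdd : BddBelow S := ⟨0, by rintro _ ⟨p, -, -, rfl⟩; positivity⟩
  set m := sInf S with hm
  have hmle : ∀ q ∈ Γ, m * ‖q.1‖ ^ 2 ≤ ‖q.2‖ ^ 2 := by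
    intro q hq
    by_cases hq0 : q.1 = 0
    · simp [hq0]
    obtain ⟨p, hp, h1, h2⟩ := hnorm q hq hq0
    rw [← h2, mul_pow]
    exact mul_le_mul_of_nonneg_right (csInf_le hSbdd ⟨p, hp, h1, rfl⟩) (by positivity)
  obtain ⟨x, -, hxlim, hxS⟩ := exists_seq_tendsto_sInf hSne hSbdd
  choose p hpΓ hp1 hp2 using hxS
  obtain ⟨B, hB⟩ := hxlim.bddAbove_range
  have hbd : ∀ n, ‖(p n).2‖ ≤ max 1 B := by
    intro n
    have h1 : ‖(p n).2‖ ^ 2 ≤ B := by rw [hp2]; exact hB ⟨n, rfl⟩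
    by_contra! h
    have h3 := (max_lt_iff.1 h)
    nlinarith
  obtain ⟨φ, hφ, h, hlim⟩ := hcp p hpΓ ⟨max 1 B, fun n => ⟨by simp [hp1], hbd n⟩⟩
  have hxφ : Tendsto (fun n => x (φ n)) atTop (𝓝 m) := hxlim.comp hφ.tendsto_atTop
  have hcau : CauchySeq (fun n => (p (φ n)).2) := by
    -- The sum `p a + p b` has energy at least `m` times its squared norm. By the parallelogram law
    -- in both components, the energy of the difference has a bound tending to `2m + 2m - 4m = 0`.
    have hpar : ∀ a b, ‖(p a).2 - (p b).2‖ ^ 2 ≤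
        2 * x a + 2 * x b - m * (4 - ‖(p a).1 - (p b).1‖ ^ 2) := by
      intro a b
      have e1 := parallelogram_law_with_norm ℂ (p a).2 (p b).2
      have e2 := parallelogram_law_with_norm ℂ (p a).1 (p b).1
      have e3 := hmle _ (Γ.add_mem (hpΓ a) (hpΓ b))
      simp only [Prod.fst_add, Prod.snd_add] at e3
      have e4 := hp2 a
      have e5 := hp2 b
      rw [hp1, hp1] at e2
      have e6 : ‖(p a).1 + (p b).1‖ ^ 2 = 4 - ‖(p a).1 - (p b).1‖ ^ 2 := by nlinarith
      rw [e6] at e3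
      nlinarith
    rw [Metric.cauchySeq_iff']
    have hc1 := hlim.cauchySeq
    have hlim2 : Tendsto (fun ab : ℕ × ℕ => 2 * x (φ ab.1) + 2 * x (φ ab.2) -
        m * (4 - ‖(p (φ ab.1)).1 - (p (φ ab.2)).1‖ ^ 2)) atTop (𝓝 0) := by
      have t1 : Tendsto (fun ab : ℕ × ℕ => x (φ ab.1)) atTop (𝓝 m) := by
        rw [← prod_atTop_atTop_eq]; exact hxφ.comp tendsto_fst
      have t2 : Tendsto (fun ab : ℕ × ℕ => x (φ ab.2)) atTop (𝓝 m) := by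
        rw [← prod_atTop_atTop_eq]; exact hxφ.comp tendsto_snd
      have t3 : Tendsto (fun ab : ℕ × ℕ => (p (φ ab.1)).1) atTop (𝓝 h) := by
        rw [← prod_atTop_atTop_eq]; exact hlim.comp tendsto_fst
      have t4 : Tendsto (fun ab : ℕ × ℕ => (p (φ ab.2)).1) atTop (𝓝 h) := by
        rw [← prod_atTop_atTop_eq]; exact hlim.comp tendsto_snd
      have := ((t1.const_mul 2).add (t2.const_mul 2)).sub
        ((tendsto_const_nhds (x := (4 : ℝ))).sub ((t3.sub t4).norm.pow 2) |>.const_mul m)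
      convert this using 2
      simp; ring
    intro ε hε
    have := (hlim2.eventually (gt_mem_nhds (show (0 : ℝ) < ε ^ 2 by positivity)))
    obtain ⟨⟨N₁, N₂⟩, hN⟩ := eventually_atTop.1 this
    refine ⟨max N₁ N₂, fun n hn => ?_⟩
    have := hN (n, max N₁ N₂) ⟨(le_max_left _ _).trans hn, le_max_right _ _⟩
    rw [dist_eq_norm]
    exact lt_of_pow_lt_pow_left₀ 2 hε.le ((hpar _ _).trans_lt this)
  obtain ⟨k, hk⟩ := cauchySeq_tendsto_of_complete hcau
  have hmem : (h, k) ∈ Γ :=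
    hcl.mem_of_tendsto (hlim.prodMk_nhds hk) (Eventually.of_forall fun n => hpΓ _)
  refine ⟨(h, k), hmem, ?_, ?_⟩
  · exact tendsto_nhds_unique hlim.norm (by simp [hp1])
  · have hkm : ‖k‖ ^ 2 = m := by
      refine tendsto_nhds_unique (hk.norm.pow 2) ?_
      simpa only [hp2] using hxφ
    simpa only [hkm] using hmle

/-- First variation: along `p + t q` the minimality defect is a nonnegative real quadratic in `t`
without constant term, so its linear coefficient vanishes. This gives the real part of the equation;
testing with `I • q` gives the imaginary part. -/
theorem isEigenpair_of_minimizer {Γ : Submodule ℂ (H × K)} {p : H × K} (hp : p ∈ Γ)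
    (hp1 : ‖p.1‖ = 1) (hmin : ∀ q ∈ Γ, ‖p.2‖ ^ 2 * ‖q.1‖ ^ 2 ≤ ‖q.2‖ ^ 2) :
    IsEigenpair Γ (‖p.2‖ ^ 2) p := by
  have hre : ∀ q ∈ Γ, (inner ℂ q.2 p.2 - ((‖p.2‖ ^ 2 : ℝ) : ℂ) * inner ℂ q.1 p.1).re = 0 := by
    intro q hq
    have hpoly : ∀ t : ℝ, 0 ≤ (‖q.2‖ ^ 2 - ‖p.2‖ ^ 2 * ‖q.1‖ ^ 2) * (t * t) +
        2 * (inner ℂ q.2 p.2 - ((‖p.2‖ ^ 2 : ℝ) : ℂ) * inner ℂ q.1 p.1).re * t + 0 := by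
      intro t
      have h := hmin _ (Γ.add_mem hp (Γ.smul_mem (t : ℂ) hq))
      simp only [Prod.fst_add, Prod.snd_add, Prod.smul_fst, Prod.smul_snd] at h
      rw [@norm_add_sq ℂ, @norm_add_sq ℂ, inner_smul_right, inner_smul_right, norm_smul,
        norm_smul, hp1] at h
      have e1 : (inner ℂ p.1 q.1).re = (inner ℂ q.1 p.1).re := inner_re_symm (𝕜 := ℂ) _ _
      have e2 : (inner ℂ p.2 q.2).re = (inner ℂ q.2 p.2).re := inner_re_symm (𝕜 := ℂ) _ _
      simp [mul_pow, e1, e2] at h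
      simp only [Complex.sub_re, Complex.re_ofReal_mul]
      nlinarith
    have hd := discrim_le_zero hpoly
    simp only [discrim, mul_zero, sub_zero] at hd
    have := pow_eq_zero_iff (two_ne_zero) |>.1 (le_antisymm hd (sq_nonneg _))
    linarith
  refine ⟨hp, fun q hq => sub_eq_zero.1 (Complex.ext (hre q hq) ?_)⟩
  have h := hre _ (Γ.smul_mem Complex.I hq)
  simp only [Prod.smul_fst, Prod.smul_snd, inner_smul_left, Complex.conj_I] at h
  rw [mul_left_comm, ← mul_sub] at h
  simpa using h

/-! ### Successive minimization: lists of low eigenpairs -/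

/-- The part of the form domain `Γ` whose first components are orthogonal to `v`. -/
noncomputable def orthogonalPart (Γ : Submodule ℂ (H × K)) {n : ℕ} (v : Fin n → H × K) :
    Submodule ℂ (H × K) :=
  Γ ⊓ ⨅ j, LinearMap.ker (((innerSL ℂ (v j).1).toLinearMap) ∘ₗ LinearMap.fst ℂ H K)

theorem mem_orthogonalPart {Γ : Submodule ℂ (H × K)} {n : ℕ} {v : Fin n → H × K} {p : H × K} :
    p ∈ orthogonalPart Γ v ↔ p ∈ Γ ∧ ∀ j, inner ℂ (v j).1 p.1 = 0 := by
  simp [orthogonalPart]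

theorem isClosed_orthogonalPart {Γ : Submodule ℂ (H × K)} (hcl : IsClosed (Γ : Set (H × K)))
    {n : ℕ} (v : Fin n → H × K) : IsClosed (orthogonalPart Γ v : Set (H × K)) := by
  have : (orthogonalPart Γ v : Set (H × K)) =
      (Γ : Set (H × K)) ∩ ⋂ j, {p : H × K | inner ℂ (v j).1 p.1 = 0} := by
    ext p; simp [mem_orthogonalPart]
  rw [this]
  exact hcl.inter (isClosed_iInter fun j =>
    isClosed_eq ((innerSL ℂ (v j).1).continuous.comp continuous_fst) continuous_const)

theorem inner_self_real (x : H) : inner ℂ x x = ((‖x‖ ^ 2 : ℝ) : ℂ) := by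
  rw [inner_self_eq_norm_sq_to_K]; norm_cast

theorem IsEigenpair.inner_left {Γ : Submodule ℂ (H × K)} {μ : ℝ} {p q : H × K}
    (hp : IsEigenpair Γ μ p) (hq : q ∈ Γ) :
    inner ℂ p.2 q.2 = (μ : ℂ) * inner ℂ p.1 q.1 := by
  rw [← inner_conj_symm, hp.2 q hq, map_mul, inner_conj_symm, Complex.conj_ofReal]

theorem IsEigenpair.norm_sq {Γ : Submodule ℂ (H × K)} {μ : ℝ} {p : H × K}
    (hp : IsEigenpair Γ μ p) : ‖p.2‖ ^ 2 = μ * ‖p.1‖ ^ 2 := by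
  have := hp.2 p hp.1
  rw [inner_self_real, inner_self_real] at this
  exact_mod_cast this

/-- Every family of `m > n` linearly independent vectors has a nontrivial combination that is
orthogonal to `n` given vectors. -/
theorem exists_combination_orthogonal {n m : ℕ} (hnm : n < m) (e : Fin n → H) (u : Fin m → H) :
    ∃ c : Fin m → ℂ, c ≠ 0 ∧ ∀ j, inner ℂ (e j) (∑ k, c k • u k) = 0 := by
  let T : (Fin m → ℂ) →ₗ[ℂ] (Fin n → ℂ) :=
    LinearMap.pi fun j => ((innerSL ℂ (e j)).toLinearMap) ∘ₗ Fintype.linearCombination ℂ u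
  obtain ⟨c, hc, hc0⟩ := Submodule.exists_mem_ne_zero_of_ne_bot
    (T.ker_ne_bot_of_finrank_lt (by simpa using hnm))
  refine ⟨c, hc0, fun j => ?_⟩
  have := congrFun (LinearMap.mem_ker.1 hc) j
  simpa [T, Fintype.linearCombination_apply, inner_sum, inner_smul_right] using this

/-- An orthonormal family of `n` eigenvectors for the `n` lowest eigenvalues. -/
structure LowEigenpairs (Γ : Submodule ℂ (H × K)) (n : ℕ) where
  vec : Fin n → H × K
  val : Fin n → ℝ
  orthonormal : Orthonormal ℂ fun j => (vec j).1
  isEigenpair : ∀ j, IsEigenpair Γ (val j) (vec j)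
  -- The bound is required only on the complement of all `n` vectors. This puts every `val j` below
  -- the next minimum, so the list need not be ordered.
  le : ∀ j, ∀ p ∈ orthogonalPart Γ vec, val j * ‖p.1‖ ^ 2 ≤ ‖p.2‖ ^ 2

/-- The domain of the form is infinite-dimensional. -/
def InfiniteDimensional (Γ : Submodule ℂ (H × K)) : Prop :=
  ∀ n, ∃ p : Fin n → H × K, (∀ j, p j ∈ Γ) ∧ LinearIndependent ℂ fun j => (p j).1

theorem exists_mem_orthogonalPart {Γ : Submodule ℂ (H × K)} {n m : ℕ} (hnm : n < m)
    (v : Fin n → H × K) (w : Fin m → H × K) (hw : ∀ j, w j ∈ Γ)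
    (hli : LinearIndependent ℂ fun j => (w j).1) :
    ∃ c : Fin m → ℂ, c ≠ 0 ∧ (∑ k, c k • w k).1 ≠ 0 ∧
      ∑ k, c k • w k ∈ orthogonalPart Γ v := by
  obtain ⟨c, hc0, hc⟩ := exists_combination_orthogonal hnm (fun j => (v j).1) fun j => (w j).1
  have hfst : (∑ k, c k • w k).1 = ∑ k, c k • (w k).1 := by simp [Prod.fst_sum]
  refine ⟨c, hc0, fun h => hc0 ?_, mem_orthogonalPart.2
    ⟨Γ.sum_mem fun k _ => Γ.smul_mem _ (hw k), fun j => by rw [hfst]; exact hc j⟩⟩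
  rw [hfst] at h
  exact funext (Fintype.linearIndependent_iff.1 hli c h)

/-- Subtracting the orthogonal projection to the low eigenvectors. -/
noncomputable def LowEigenpairs.residual {Γ : Submodule ℂ (H × K)} {n : ℕ}
    (s : LowEigenpairs Γ n) (q : H × K) : H × K :=
  q - ∑ j, inner ℂ (s.vec j).1 q.1 • s.vec j

theorem LowEigenpairs.residual_mem {Γ : Submodule ℂ (H × K)} {n : ℕ}
    (s : LowEigenpairs Γ n) {q : H × K} (hq : q ∈ Γ) :
    s.residual q ∈ orthogonalPart Γ s.vec := by
  refine mem_orthogonalPart.2 ⟨Γ.sub_mem hq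
    (Γ.sum_mem fun j _ => Γ.smul_mem _ (s.isEigenpair j).1), fun j => ?_⟩
  have := s.orthonormal.inner_right_fintype (fun j => inner ℂ (s.vec j).1 q.1) j
  simp only [residual, Prod.fst_sub, Prod.fst_sum, Prod.smul_fst, inner_sub_right]
  rw [this, sub_self]

theorem LowEigenpairs.eq_residual_add {Γ : Submodule ℂ (H × K)} {n : ℕ}
    (s : LowEigenpairs Γ n) (q : H × K) :
    q = s.residual q + ∑ j, inner ℂ (s.vec j).1 q.1 • s.vec j := by
  simp [residual]

theorem LowEigenpairs.inner_snd_eq_zero {Γ : Submodule ℂ (H × K)} {n : ℕ}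
    (s : LowEigenpairs Γ n) {p : H × K} (hp : p ∈ orthogonalPart Γ s.vec) (j : Fin n) :
    inner ℂ (s.vec j).2 p.2 = 0 := by
  obtain ⟨h1, h2⟩ := mem_orthogonalPart.1 hp
  rw [(s.isEigenpair j).inner_left h1, h2, mul_zero]

/-- The next eigenvalue after the lowest `n` ones. -/
theorem LowEigenpairs.exists_next [CompleteSpace K] {Γ : Submodule ℂ (H × K)}
    (hcl : IsClosed (Γ : Set (H × K))) (hcp : CompactEmbedding Γ)
    (hinf : InfiniteDimensional Γ) {n : ℕ} (s : LowEigenpairs Γ n) :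
    ∃ (μ : ℝ) (p : H × K), p ∈ orthogonalPart Γ s.vec ∧ ‖p.1‖ = 1 ∧ IsEigenpair Γ μ p ∧
      ∀ q ∈ orthogonalPart Γ s.vec, μ * ‖q.1‖ ^ 2 ≤ ‖q.2‖ ^ 2 := by
  have hne : ∃ p ∈ orthogonalPart Γ s.vec, p.1 ≠ 0 := by
    obtain ⟨w, hw, hli⟩ := hinf (n + 1)
    obtain ⟨c, -, h0, h1⟩ := exists_mem_orthogonalPart (Nat.lt_succ_self n) s.vec w hw hli
    exact ⟨_, h1, h0⟩
  have hcp' : CompactEmbedding (orthogonalPart Γ s.vec) :=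
    fun p hp hb => hcp p (fun n => (mem_orthogonalPart.1 (hp n)).1) hb
  obtain ⟨p, hp, hp1, hmin⟩ := exists_minimizer (isClosed_orthogonalPart hcl s.vec) hcp' hne
  have hE := isEigenpair_of_minimizer hp hp1 hmin
  obtain ⟨hpΓ, hporth⟩ := mem_orthogonalPart.1 hp
  refine ⟨‖p.2‖ ^ 2, p, hp, hp1, ⟨hpΓ, fun q hq => ?_⟩, hmin⟩
  -- The minimizer is so far tested only against the orthogonal part. The projection of `q` to the
  -- old eigenvectors contributes zero to both sides.
  have h1 := hE.2 _ (s.residual_mem hq)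
  rw [s.eq_residual_add q]
  simp only [Prod.fst_add, Prod.snd_add, Prod.fst_sum, Prod.snd_sum, Prod.smul_fst,
    Prod.smul_snd, inner_add_left, sum_inner, inner_smul_left, h1, mul_add]
  simp [hporth, s.inner_snd_eq_zero hp]

/-- Adding the next eigenpair to the list. -/
noncomputable def LowEigenpairs.cons {Γ : Submodule ℂ (H × K)} {n : ℕ} (s : LowEigenpairs Γ n)
    {μ : ℝ} {p : H × K} (hp : p ∈ orthogonalPart Γ s.vec) (hp1 : ‖p.1‖ = 1)
    (hE : IsEigenpair Γ μ p)
    (hmin : ∀ q ∈ orthogonalPart Γ s.vec, μ * ‖q.1‖ ^ 2 ≤ ‖q.2‖ ^ 2) :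
    LowEigenpairs Γ (n + 1) where
  vec := Fin.cons p s.vec
  val := Fin.cons μ s.val
  orthonormal := by
    have hporth := (mem_orthogonalPart.1 hp).2
    constructor
    · intro j
      refine Fin.cases ?_ (fun j => ?_) j
      · simpa using hp1
      · simpa using s.orthonormal.1 j
    · intro j k
      induction j using Fin.cases with
      | zero =>
        induction k using Fin.cases with
        | zero => simp
        | succ k => exact fun _ => by simpa using inner_eq_zero_symm.1 (hporth k)
      | succ j =>
        induction k using Fin.cases with
        | zero => exact fun _ => by simpa using hporth j
        | succ k =>
          intro hjk
          simpa using s.orthonormal.2 (fun h => hjk (by rw [h]))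
  isEigenpair := Fin.cases (by simpa using hE) (fun j => by simpa using s.isEigenpair j)
  le := by
    intro j q hq
    have hq' : q ∈ orthogonalPart Γ s.vec := by
      obtain ⟨h1, h2⟩ := mem_orthogonalPart.1 hq
      exact mem_orthogonalPart.2 ⟨h1, fun k => by simpa using h2 k.succ⟩
    refine Fin.cases ?_ (fun j => ?_) j
    · simpa using hmin q hq'
    · simpa using s.le j q hq'

theorem nonempty_lowEigenpairs [CompleteSpace K] {Γ : Submodule ℂ (H × K)}
    (hcl : IsClosed (Γ : Set (H × K))) (hcp : CompactEmbedding Γ)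
    (hinf : InfiniteDimensional Γ) (n : ℕ) : Nonempty (LowEigenpairs Γ n) := by
  induction n with
  | zero =>
    exact ⟨{ vec := Fin.elim0, val := Fin.elim0
             orthonormal := ⟨fun j => j.elim0, fun j => j.elim0⟩
             isEigenpair := fun j => j.elim0, le := fun j => j.elim0 }⟩
  | succ n ih =>
    obtain ⟨s⟩ := ih
    obtain ⟨μ, p, hp, hp1, hE, hmin⟩ := s.exists_next hcl hcp hinf
    exact ⟨s.cons hp hp1 hE hmin⟩

/-- The eigenvectors diagonalize both quadratic forms: the squared norm is `∑ ‖c j‖²` and the energy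
is `∑ val j ‖c j‖²`. -/
theorem LowEigenpairs.norm_sq_combination_le {Γ : Submodule ℂ (H × K)} {n : ℕ}
    (s : LowEigenpairs Γ n) {m : ℝ} (hm : ∀ j, s.val j ≤ m) (c : Fin n → ℂ) :
    ‖(∑ j, c j • s.vec j).2‖ ^ 2 ≤ m * ‖(∑ j, c j • s.vec j).1‖ ^ 2 := by
  have hmem : ∑ j, c j • s.vec j ∈ Γ := Γ.sum_mem fun j _ => Γ.smul_mem _ (s.isEigenpair j).1
  have hin : ∀ j, inner ℂ (∑ k, c k • s.vec k).1 (s.vec j).1 = starRingEnd ℂ (c j) := by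
    intro j
    rw [Prod.fst_sum]
    exact s.orthonormal.inner_left_fintype c j
  have h2 : ‖(∑ j, c j • s.vec j).2‖ ^ 2 = ∑ j, s.val j * ‖c j‖ ^ 2 := by
    apply Complex.ofReal_injective
    rw [← inner_self_real]
    conv_lhs => arg 3; rw [Prod.snd_sum]
    rw [inner_sum, Complex.ofReal_sum]
    refine Finset.sum_congr rfl fun j _ => ?_
    rw [Prod.smul_snd, inner_smul_right, (s.isEigenpair j).2 _ hmem, hin]
    rw [mul_left_comm, Complex.mul_conj, Complex.normSq_eq_norm_sq]
    push_cast; ring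
  have h1 : ‖(∑ j, c j • s.vec j).1‖ ^ 2 = ∑ j, ‖c j‖ ^ 2 := by
    apply Complex.ofReal_injective
    rw [← inner_self_real]
    conv_lhs => arg 3; rw [Prod.fst_sum]
    rw [inner_sum, Complex.ofReal_sum]
    refine Finset.sum_congr rfl fun j _ => ?_
    rw [Prod.smul_fst, inner_smul_right, hin, Complex.mul_conj, Complex.normSq_eq_norm_sq]
  rw [h1, h2, Finset.mul_sum]
  exact Finset.sum_le_sum fun j _ => mul_le_mul_of_nonneg_right (hm j) (by positivity)

/-! ### Counting eigenvalues and the min-max principle -/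

/-- The levels `t` up to which there are at least `i` eigenvalues. -/
def levels (Γ : Submodule ℂ (H × K)) (i : ℕ) : Set ℝ :=
  {t | ∃ p : Fin i → H × K, LinearIndependent ℂ (fun j => (p j).1) ∧
    ∀ j, ∃ μ : ℝ, μ ≤ t ∧ IsEigenpair Γ μ (p j)}

/-- An eigenvector with eigenvalue below `m` has a residual with Rayleigh quotient below `m`, unless
its first component is zero. So `n + 1` such eigenvectors would have first components in the span of
`n` vectors, against independence. -/
theorem LowEigenpairs.le_of_mem_levels {Γ : Submodule ℂ (H × K)} {n : ℕ}
    (s : LowEigenpairs Γ n) {m : ℝ}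
    (hmin : ∀ q ∈ orthogonalPart Γ s.vec, m * ‖q.1‖ ^ 2 ≤ ‖q.2‖ ^ 2) {t : ℝ}
    (ht : t ∈ levels Γ (n + 1)) : m ≤ t := by
  obtain ⟨p, hli, hp⟩ := ht
  choose μ hμ hE using hp
  by_contra! htm
  have hres : ∀ j, (s.residual (p j)).1 = 0 := by
    intro j
    set r := s.residual (p j) with hr
    have hrmem : r ∈ orthogonalPart Γ s.vec := s.residual_mem (hE j).1
    obtain ⟨hrΓ, hrorth⟩ := mem_orthogonalPart.1 hrmem
    have h1 : ‖r.2‖ ^ 2 = μ j * ‖r.1‖ ^ 2 := by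
      have h := (hE j).2 r hrΓ
      rw [s.eq_residual_add (p j), ← hr] at h
      simp only [Prod.fst_add, Prod.snd_add, Prod.fst_sum, Prod.snd_sum, Prod.smul_fst,
        Prod.smul_snd, inner_add_right, inner_sum, inner_smul_right,
        inner_eq_zero_symm.1 (s.inner_snd_eq_zero hrmem _), inner_eq_zero_symm.1 (hrorth _),
        mul_zero, Finset.sum_const_zero, add_zero] at h
      rw [inner_self_real, inner_self_real] at h
      exact_mod_cast h
    have h2 := hmin r hrmem
    have h3 : ‖r.1‖ ^ 2 ≤ 0 := by nlinarith [hμ j, sq_nonneg ‖r.1‖]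
    simpa using le_antisymm h3 (sq_nonneg _)
  -- This nonzero combination is orthogonal to the low eigenvectors and also lies in their span,
  -- hence is orthogonal to itself.
  obtain ⟨c, -, h0, h1⟩ := exists_mem_orthogonalPart (Nat.lt_succ_self n) s.vec p
    (fun j => (hE j).1) hli
  set q := ∑ k, c k • p k with hq
  have horth := (mem_orthogonalPart.1 h1).2
  apply h0
  rw [← inner_self_eq_zero (𝕜 := ℂ)]
  conv_lhs => arg 3; rw [hq, Prod.fst_sum]
  rw [inner_sum]
  refine Finset.sum_eq_zero fun k _ => ?_
  rw [s.eq_residual_add (p k)]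
  simp [hres, Prod.fst_sum, inner_sum, inner_smul_right, inner_eq_zero_symm.1 (horth _)]

/-- Existence and variational characterization of the `(n + 1)`-st eigenvalue. -/
theorem exists_isLeast_levels [CompleteSpace K] {Γ : Submodule ℂ (H × K)}
    (hcl : IsClosed (Γ : Set (H × K))) (hcp : CompactEmbedding Γ)
    (hinf : InfiniteDimensional Γ) (n : ℕ) :
    ∃ m : ℝ, 0 ≤ m ∧ IsLeast (levels Γ (n + 1)) m ∧
      (∃ w : Fin (n + 1) → H × K, (∀ j, w j ∈ Γ) ∧ LinearIndependent ℂ (fun j => (w j).1) ∧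
        ∀ c : Fin (n + 1) → ℂ, ‖(∑ j, c j • w j).2‖ ^ 2 ≤ m * ‖(∑ j, c j • w j).1‖ ^ 2) ∧
      ∀ (t : ℝ) (w : Fin (n + 1) → H × K), (∀ j, w j ∈ Γ) →
        LinearIndependent ℂ (fun j => (w j).1) →
        (∀ c : Fin (n + 1) → ℂ, ‖(∑ j, c j • w j).2‖ ^ 2 ≤ t * ‖(∑ j, c j • w j).1‖ ^ 2) →
        m ≤ t := by
  obtain ⟨s⟩ := nonempty_lowEigenpairs hcl hcp hinf n
  obtain ⟨m, p, hp, hp1, hE, hmin⟩ := s.exists_next hcl hcp hinf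
  have hpm : ‖p.2‖ ^ 2 = m := by rw [hE.norm_sq, hp1]; ring
  let s' := s.cons hp hp1 hE hmin
  have hval : ∀ j, s'.val j ≤ m := by
    intro j
    refine Fin.cases le_rfl (fun j => ?_) j
    have := s.le j p hp
    rw [hp1, hpm] at this
    change s.val j ≤ m
    linarith
  refine ⟨m, hpm ▸ sq_nonneg _, ⟨⟨s'.vec, s'.orthonormal.linearIndependent, fun j =>
    ⟨s'.val j, hval j, s'.isEigenpair j⟩⟩, fun t ht => s.le_of_mem_levels hmin ht⟩,
    ⟨s'.vec, fun j => (s'.isEigenpair j).1, s'.orthonormal.linearIndependent,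
      s'.norm_sq_combination_le hval⟩, fun t w hw hli hle => ?_⟩
  -- A trial space of dimension `n + 1` meets the complement of `n` vectors, where the quotient is
  -- at least `m`.
  obtain ⟨c, -, h0, h1⟩ := exists_mem_orthogonalPart (Nat.lt_succ_self n) s.vec w hw hli
  exact le_of_mul_le_mul_right ((hmin _ h1).trans (hle c)) (by positivity)

end FormGraph

/-! ### Energies of different orders -/

namespace StableEig

open Filter Topology
open scoped SchwartzMap

variable {d : ℕ}

theorem enorm_sq_eq_lintegral (u : L2 d) : ‖u‖ₑ ^ 2 = ∫⁻ x, ‖u x‖ₑ ^ 2 := by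
  have h := eLpNorm_nnreal_pow_eq_lintegral (μ := volume) (f := u) (p := 2) two_ne_zero
  rw [Lp.enorm_def]
  simpa using h

theorem enorm_fourier (u : L2 d) : ‖(𝓕 u : L2 d)‖ₑ = ‖u‖ₑ := by
  rw [← ofReal_norm, ← ofReal_norm, Lp.norm_fourier_eq]

theorem memLp_two_of_lintegral_lt_top {f : EuclideanSpace ℝ (Fin d) → ℂ}
    (hf : AEStronglyMeasurable f volume) (h : ∫⁻ x, ‖f x‖ₑ ^ 2 < ⊤) : MemLp f 2 volume := by
  refine ⟨hf, ?_⟩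
  have h2 := eLpNorm_nnreal_pow_eq_lintegral (μ := volume) (f := f) (p := 2) two_ne_zero
  have h3 : eLpNorm f 2 volume ^ 2 < ⊤ := by
    have : eLpNorm f 2 volume ^ 2 = ∫⁻ x, ‖f x‖ₑ ^ 2 := by simpa using h2
    rwa [this]
  by_contra hc
  rw [not_lt, top_le_iff] at hc
  simp [hc] at h3

theorem exists_ae_tendsto_subseq {u : ℕ → L2 d} {v : L2 d} (h : Tendsto u atTop (𝓝 v)) :
    ∃ φ : ℕ → ℕ, StrictMono φ ∧
      ∀ᵐ x ∂(volume : Measure (EuclideanSpace ℝ (Fin d))),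
        Tendsto (fun n => u (φ n) x) atTop (𝓝 (v x)) :=
  (tendstoInMeasure_of_tendsto_Lp h).exists_seq_tendsto_ae

theorem stableSymbol_nonneg (α : ℝ) (ξ : EuclideanSpace ℝ (Fin d)) : 0 ≤ stableSymbol α ξ := by
  unfold stableSymbol; positivity

theorem continuous_stableSymbol {α : ℝ} (hα : 0 < α) :
    Continuous (stableSymbol (d := d) α) := by
  unfold stableSymbol
  exact (continuous_const.mul continuous_norm).rpow_const fun _ => Or.inr hα.le

/-- Hölder's inequality with weights `α/β` and `1 - α/β`, after Plancherel turns `‖u‖` into `‖û‖`.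
-/
theorem energy_le_rpow_mul_rpow {α β : ℝ} (hα : 0 < α) (hαβ : α < β) (u : L2 d) :
    energy α u ≤ energy β u ^ (α / β) * (‖u‖ₑ ^ 2) ^ (1 - α / β) := by
  have hβ : 0 < β := hα.trans hαβ
  have hθ : 0 < α / β := by positivity
  have hθ1 : α / β < 1 := (div_lt_one hβ).2 hαβ
  rw [← enorm_fourier u, enorm_sq_eq_lintegral]
  have hm : AEMeasurable (fun ξ => ‖(𝓕 u : L2 d) ξ‖ₑ ^ 2) volume :=
    (Lp.aestronglyMeasurable _).enorm.pow_const 2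
  have hs : AEMeasurable
      (fun ξ : EuclideanSpace ℝ (Fin d) => ENNReal.ofReal (stableSymbol β ξ)) volume :=
    (continuous_stableSymbol hβ).measurable.ennreal_ofReal.aemeasurable
  refine le_trans (le_of_eq ?_) (ENNReal.lintegral_mul_norm_pow_le (hs.mul hm) hm hθ.le
    (sub_nonneg.2 hθ1.le) (by ring))
  refine lintegral_congr fun ξ => ?_
  rw [Pi.mul_apply, ENNReal.mul_rpow_of_nonneg _ _ hθ.le, mul_assoc,
    ← ENNReal.rpow_add_of_nonneg _ _ hθ.le (sub_nonneg.2 hθ1.le), add_sub_cancel, ENNReal.rpow_one,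
    ENNReal.ofReal_rpow_of_nonneg (stableSymbol_nonneg _ _) hθ.le]
  congr 2
  unfold stableSymbol
  rw [← Real.rpow_mul (by positivity), mul_div_cancel₀ _ hβ.ne']

theorem energy_le_energy_add {α β : ℝ} (hα : 0 < α) (hαβ : α < β) (u : L2 d) :
    energy α u ≤ energy β u + ‖u‖ₑ ^ 2 := by
  have hβ : 0 < β := hα.trans hαβ
  have hθ : 0 ≤ α / β := by positivity
  have hθ1 : 0 ≤ 1 - α / β := sub_nonneg.2 ((div_lt_one hβ).2 hαβ).le
  refine (energy_le_rpow_mul_rpow hα hαβ u).trans ?_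
  calc energy β u ^ (α / β) * (‖u‖ₑ ^ 2) ^ (1 - α / β)
      ≤ (energy β u + ‖u‖ₑ ^ 2) ^ (α / β) * (energy β u + ‖u‖ₑ ^ 2) ^ (1 - α / β) :=
        mul_le_mul' (ENNReal.rpow_le_rpow le_self_add hθ) (ENNReal.rpow_le_rpow le_add_self hθ1)
    _ = energy β u + ‖u‖ₑ ^ 2 := by
        rw [← ENNReal.rpow_add_of_nonneg _ _ hθ hθ1, add_sub_cancel, ENNReal.rpow_one]

theorem killedFormDomain_anti {α β : ℝ} (hα : 0 < α) (hαβ : α < β)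
    (D : Set (EuclideanSpace ℝ (Fin d))) : killedFormDomain β D ⊆ killedFormDomain α D := by
  rintro u ⟨hu, happ⟩
  have hnorm : ∀ v : L2 d, ‖v‖ₑ ^ 2 < ⊤ := fun v => ENNReal.pow_lt_top enorm_lt_top
  refine ⟨(energy_le_energy_add hα hαβ u).trans_lt (ENNReal.add_lt_top.2 ⟨hu, hnorm u⟩),
    fun ε hε => ?_⟩
  obtain ⟨φ, hφ, h⟩ := happ (ε / 2) (ENNReal.half_pos hε.ne')
  refine ⟨φ, hφ, ?_⟩
  calc energy α (u - φ) + ‖u - φ‖ₑ ^ 2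
      ≤ (energy β (u - φ) + ‖u - φ‖ₑ ^ 2) + (energy β (u - φ) + ‖u - φ‖ₑ ^ 2) :=
        add_le_add (energy_le_energy_add hα hαβ _) le_add_self
    _ < ε / 2 + ε / 2 := ENNReal.add_lt_add h h
    _ = ε := ENNReal.add_halves ε

/-! ### Pointwise Fourier transform on sets of finite measure -/

/-- The Plancherel transform of an integrable `u ∈ L²` is given by the Fourier integral. -/
theorem fourier_ae_eq_integral {u : L2 d} (hu : Integrable u volume) :
    (𝓕 u : L2 d) =ᵐ[volume] 𝓕 (u : EuclideanSpace ℝ (Fin d) → ℂ) := by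
  have hcont : Continuous (𝓕 (u : EuclideanSpace ℝ (Fin d) → ℂ)) :=
    VectorFourier.fourierIntegral_continuous Real.continuous_fourierChar
      continuous_inner hu
  -- Both transforms satisfy `∫ g û = ∫ ĝ u` for smooth compactly supported `g`: one through
  -- tempered distributions, the other through Fubini.
  refine ae_eq_of_integral_contDiff_smul_eq ((Lp.memLp _).locallyIntegrable (by norm_num))
    hcont.locallyIntegrable fun g hg hgc => ?_
  have hg1 : HasCompactSupport (fun x => (g x : ℂ)) := hgc.comp_left Complex.ofReal_zero
  have hg2 : ContDiff ℝ ∞ (fun x => (g x : ℂ)) := Complex.ofRealCLM.contDiff.comp hg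
  let G : 𝓢(EuclideanSpace ℝ (Fin d), ℂ) := hg1.toSchwartzMap hg2
  have h1 := congrArg (fun T => T G) (Lp.fourier_toTemperedDistribution_eq u)
  simp only [TemperedDistribution.fourier_apply, Lp.toTemperedDistribution_apply] at h1
  have h2 := VectorFourier.integral_fourierIntegral_smul_eq_flip
    (L := innerₗ (EuclideanSpace ℝ (Fin d))) (f := G) (g := u) Real.continuous_fourierChar
    continuous_inner (G.integrable (μ := volume)) hu
  rw [flip_innerₗ] at h2
  have h3 : ∫ x, G x • (𝓕 u : L2 d) x = ∫ x, G x • 𝓕 (u : EuclideanSpace ℝ (Fin d) → ℂ) x := by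
    rw [← h1]; exact h2
  simpa [G] using h3

/-- Functions in `L²` that vanish almost everywhere outside `D`. -/
def VanishesOff (D : Set (EuclideanSpace ℝ (Fin d))) (u : L2 d) : Prop :=
  ∀ᵐ x ∂volume, x ∉ D → u x = 0

/-- On functions that vanish outside a set of finite measure, the values of the Fourier transform
are uniformly bounded linear functionals. -/
theorem exists_fourier_eq_inner {D : Set (EuclideanSpace ℝ (Fin d))} (hD : MeasurableSet D)
    (hfin : volume D < ⊤) :
    ∃ (E : EuclideanSpace ℝ (Fin d) → L2 d) (M : ℝ), (∀ ξ, ‖E ξ‖ ≤ M) ∧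
      ∀ u, VanishesOff D u → ∀ᵐ ξ ∂volume, (𝓕 u : L2 d) ξ = inner ℂ (E ξ) u := by
  -- The exponent has a positive sign since the inner product conjugates its first argument. The
  -- norm bound is that of the indicator of `D`.
  let e : EuclideanSpace ℝ (Fin d) → EuclideanSpace ℝ (Fin d) → ℂ := fun ξ =>
    D.indicator fun x => (Real.fourierChar (inner ℝ x ξ) : ℂ)
  have hcont : ∀ ξ, Continuous fun x : EuclideanSpace ℝ (Fin d) =>
      (Real.fourierChar (inner ℝ x ξ) : ℂ) := fun ξ =>
    continuous_subtype_val.comp (Real.continuous_fourierChar.comp (by fun_prop))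
  have hmeas : ∀ ξ, AEStronglyMeasurable (e ξ) volume := fun ξ =>
    (hcont ξ).aestronglyMeasurable.indicator hD
  have hnorm : ∀ ξ x, ‖e ξ x‖ ≤ ‖D.indicator (fun _ => (1 : ℂ)) x‖ := by
    intro ξ x
    by_cases hx : x ∈ D
    · simpa [e, hx] using (Circle.norm_coe _).le
    · simp [e, hx]
  have hone : MemLp (D.indicator fun _ => (1 : ℂ)) 2 volume :=
    memLp_indicator_const 2 hD 1 (Or.inr hfin.ne)
  have hmem : ∀ ξ, MemLp (e ξ) 2 volume := fun ξ =>
    hone.mono (hmeas ξ) (ae_of_all _ (hnorm ξ))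
  refine ⟨fun ξ => (hmem ξ).toLp (e ξ), ‖hone.toLp _‖, fun ξ => ?_, fun u hu => ?_⟩
  · refine Lp.norm_le_norm_of_ae_le ?_
    filter_upwards [(hmem ξ).coeFn_toLp, hone.coeFn_toLp] with x h1 h2
    rw [h1, h2]; exact hnorm ξ x
  · have hint : Integrable u volume := by
      have h1 : IntegrableOn u D volume := by
        have : IsFiniteMeasure (volume.restrict D) := ⟨by simpa using hfin⟩
        exact ((Lp.memLp u).restrict D).integrable (by norm_num)
      refine (integrable_indicator_iff hD).2 h1 |>.congr ?_
      filter_upwards [hu] with x hx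
      by_cases hxD : x ∈ D <;> simp [hxD, hx]
    filter_upwards [fourier_ae_eq_integral hint] with ξ hξ
    rw [hξ, Real.fourier_eq, L2.inner_def]
    refine integral_congr_ae ?_
    filter_upwards [(hmem ξ).coeFn_toLp, hu] with x h1 h2
    rw [h1]
    by_cases hxD : x ∈ D
    · simp only [e, Set.indicator_of_mem hxD, RCLike.inner_apply]
      rw [← Circle.coe_inv_eq_conj, ← AddChar.map_neg_eq_inv, Circle.smul_def, smul_eq_mul,
        mul_comm]
    · simp [h2 hxD]

/-! ### The energy as a Hilbert space norm -/

theorem coeFn_fourier_add (u v : L2 d) :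
    (𝓕 (u + v) : L2 d) =ᵐ[volume] fun ξ => (𝓕 u : L2 d) ξ + (𝓕 v : L2 d) ξ := by
  rw [FourierTransform.fourier_add]
  exact Lp.coeFn_add _ _

theorem coeFn_fourier_smul (c : ℂ) (u : L2 d) :
    (𝓕 (c • u) : L2 d) =ᵐ[volume] fun ξ => c * (𝓕 u : L2 d) ξ := by
  rw [FourierTransform.fourier_smul]
  exact Lp.coeFn_smul _ _

/-- The graph of the Fourier multiplier `|2πξ|^{α/2}` followed by the Fourier transform:
the pairs `(u, |2πξ|^{α/2} û)`. -/
noncomputable def multiplierGraph (d : ℕ) (α : ℝ) : Submodule ℂ (L2 d × L2 d) where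
  carrier := {p | p.2 =ᵐ[volume] fun ξ => (√(stableSymbol α ξ) : ℂ) * (𝓕 p.1 : L2 d) ξ}
  zero_mem' := by
    have h0 : (𝓕 (0 : L2 d) : L2 d) = 0 := FourierTransform.fourier_zero ..
    change ((0 : L2 d) : EuclideanSpace ℝ (Fin d) → ℂ) =ᵐ[volume] fun ξ =>
      (√(stableSymbol α ξ) : ℂ) * (𝓕 (0 : L2 d) : L2 d) ξ
    rw [h0]
    filter_upwards [Lp.coeFn_zero ℂ 2 (volume : Measure (EuclideanSpace ℝ (Fin d)))] with ξ h
    rw [h, Pi.zero_apply, mul_zero]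
  add_mem' := by
    rintro ⟨u, g⟩ ⟨v, k⟩ hu hv
    filter_upwards [hu, hv, Lp.coeFn_add g k, coeFn_fourier_add u v] with ξ h1 h2 h3 h4
    simp only [Prod.mk_add_mk, h3, h4, Pi.add_apply] at *
    rw [h1, h2, mul_add]
  smul_mem' := by
    rintro c ⟨u, g⟩ hu
    filter_upwards [hu, Lp.coeFn_smul c g, coeFn_fourier_smul c u] with ξ h1 h3 h4
    simp only [Prod.smul_mk, h3, h4, Pi.smul_apply, smul_eq_mul] at *
    rw [h1, mul_left_comm]

/-- The defining relation is pointwise, so it survives a.e. convergence of a common subsequence of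
the transforms and of the second components. -/
theorem isClosed_multiplierGraph (α : ℝ) :
    IsClosed (multiplierGraph d α : Set (L2 d × L2 d)) := by
  refine IsSeqClosed.isClosed fun p q hp hlim => ?_
  have h1 : Tendsto (fun n => (𝓕 (p n).1 : L2 d)) atTop (𝓝 (𝓕 q.1)) :=
    ((FourierTransform.continuous_fourier (E := L2 d)).comp
      continuous_fst).continuousAt.tendsto.comp hlim
  have h2 : Tendsto (fun n => (p n).2) atTop (𝓝 q.2) :=
    continuous_snd.continuousAt.tendsto.comp hlim
  obtain ⟨φ, hφ, hae⟩ := exists_ae_tendsto_subseq h1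
  obtain ⟨ψ, hψ, hae'⟩ := exists_ae_tendsto_subseq (h2.comp hφ.tendsto_atTop)
  have hp' : ∀ᵐ ξ ∂volume, ∀ n, (p n).2 ξ = (√(stableSymbol α ξ) : ℂ) * (𝓕 (p n).1 : L2 d) ξ :=
    ae_all_iff.2 fun n => hp n
  filter_upwards [hae, hae', hp'] with ξ h3 h4 h5
  refine tendsto_nhds_unique h4 ?_
  simp only [Function.comp_apply, h5]
  exact (h3.comp hψ.tendsto_atTop).const_mul _

theorem energy_eq_enorm_sq {α : ℝ} {p : L2 d × L2 d} (hp : p ∈ multiplierGraph d α) :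
    energy α p.1 = ‖p.2‖ₑ ^ 2 := by
  rw [enorm_sq_eq_lintegral]
  refine lintegral_congr_ae ?_
  filter_upwards [hp] with ξ h
  rw [h, enorm_mul, mul_pow]
  congr 1
  rw [← ofReal_norm, ← ENNReal.ofReal_pow (norm_nonneg _), Complex.norm_real, Real.norm_eq_abs,
    sq_abs, Real.sq_sqrt (stableSymbol_nonneg _ _)]

theorem exists_mem_multiplierGraph {α : ℝ} (hα : 0 < α) {u : L2 d} (hu : u ∈ formDomain d α) :
    ∃ g, (u, g) ∈ multiplierGraph d α := by
  have hmem : MemLp (fun ξ => (√(stableSymbol α ξ) : ℂ) * (𝓕 u : L2 d) ξ) 2 volume := by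
    refine memLp_two_of_lintegral_lt_top ?_ (lt_of_eq_of_lt ?_ hu)
    · exact (Complex.continuous_ofReal.comp
        (continuous_stableSymbol hα).sqrt).aestronglyMeasurable.mul (Lp.aestronglyMeasurable _)
    · refine lintegral_congr fun ξ => ?_
      rw [enorm_mul, mul_pow]
      congr 1
      rw [← ofReal_norm, ← ENNReal.ofReal_pow (norm_nonneg _), Complex.norm_real,
        Real.norm_eq_abs, sq_abs, Real.sq_sqrt (stableSymbol_nonneg _ _)]
  exact ⟨hmem.toLp _, hmem.coeFn_toLp⟩

theorem dirichletForm_eq_inner {α : ℝ} {p q : L2 d × L2 d} (hp : p ∈ multiplierGraph d α)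
    (hq : q ∈ multiplierGraph d α) : dirichletForm α p.1 q.1 = inner ℂ p.2 q.2 := by
  rw [L2.inner_def]
  refine integral_congr_ae ?_
  filter_upwards [hp, hq] with ξ h1 h2
  have h3 : (stableSymbol α ξ : ℂ) = (√(stableSymbol α ξ) : ℂ) * (√(stableSymbol α ξ) : ℂ) := by
    rw [← Complex.ofReal_mul, Real.mul_self_sqrt (stableSymbol_nonneg _ _)]
  rw [h1, h2, h3]
  simp only [RCLike.inner_apply, map_mul, Complex.conj_ofReal]
  ring

/-! ### The form domain of the killed process as a closed graph -/

/-- The classes of test functions form a subspace. -/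
def testSubmodule (D : Set (EuclideanSpace ℝ (Fin d))) : Submodule ℂ (L2 d) where
  carrier := testFunctions D
  zero_mem' := ⟨0, contDiff_const, HasCompactSupport.zero, by simp [tsupport], Lp.coeFn_zero _ _ _⟩
  add_mem' := by
    rintro u v ⟨φ, h1, h2, h3, h4⟩ ⟨ψ, k1, k2, k3, k4⟩
    exact ⟨φ + ψ, h1.add k1, h2.add k2, (tsupport_add _ _).trans (Set.union_subset h3 k3),
      (Lp.coeFn_add _ _).trans (h4.add k4)⟩
  smul_mem' := by
    rintro c u ⟨φ, h1, h2, h3, h4⟩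
    refine ⟨c • φ, contDiff_const.smul h1, h2.smul_left (f := fun _ => c),
      (closure_mono (Function.support_const_smul_subset c φ)).trans h3, ?_⟩
    filter_upwards [Lp.coeFn_smul c u, h4] with x h5 h6
    rw [h5, Pi.smul_apply, Pi.smul_apply, h6]

/-- The closure of the test functions in the form norm, each function `u` being listed together
with `|2πξ|^{α/2} û`. -/
noncomputable def formGraph (α : ℝ) (D : Set (EuclideanSpace ℝ (Fin d))) :
    Submodule ℂ (L2 d × L2 d) :=
  (multiplierGraph d α ⊓ (testSubmodule D).comap (LinearMap.fst ℂ _ _)).topologicalClosure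

theorem isClosed_formGraph (α : ℝ) (D : Set (EuclideanSpace ℝ (Fin d))) :
    IsClosed (formGraph α D : Set (L2 d × L2 d)) :=
  Submodule.isClosed_topologicalClosure _

theorem formGraph_le_multiplierGraph (α : ℝ) (D : Set (EuclideanSpace ℝ (Fin d))) :
    formGraph α D ≤ multiplierGraph d α :=
  Submodule.topologicalClosure_minimal _ inf_le_left (isClosed_multiplierGraph α)

theorem mem_formGraph_iff {α : ℝ} {D : Set (EuclideanSpace ℝ (Fin d))} {p : L2 d × L2 d} :
    p ∈ formGraph α D ↔ ∀ ε : ENNReal, 0 < ε →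
      ∃ q ∈ multiplierGraph d α, q.1 ∈ testFunctions D ∧ ‖p.1 - q.1‖ₑ < ε ∧ ‖p.2 - q.2‖ₑ < ε := by
  rw [← SetLike.mem_coe, formGraph, Submodule.topologicalClosure_coe, EMetric.mem_closure_iff]
  refine forall₂_congr fun ε _ => exists_congr fun q => ?_
  rw [Prod.edist_eq, max_lt_iff, edist_eq_enorm_sub, edist_eq_enorm_sub]
  exact and_assoc

theorem mem_formGraph_of_mem_killedFormDomain {α : ℝ} (hα : 0 < α)
    {D : Set (EuclideanSpace ℝ (Fin d))} {u : L2 d} (hu : u ∈ killedFormDomain α D) :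
    ∃ g, (u, g) ∈ formGraph α D := by
  obtain ⟨g, hg⟩ := exists_mem_multiplierGraph hα hu.1
  refine ⟨g, mem_formGraph_iff.2 fun ε hε => ?_⟩
  obtain ⟨φ, hφ, hlt⟩ := hu.2 (ε ^ 2) (ENNReal.pow_pos hε 2)
  obtain ⟨k, hk⟩ := exists_mem_multiplierGraph hα
    (show u - φ ∈ formDomain d α from (le_self_add.trans_lt hlt).trans_le le_top)
  -- The first component is `φ`, so the pair lies over a test function, and its distance to `(u, g)`
  -- is read off from `(u - φ, k)`.
  refine ⟨(u, g) - (u - φ, k), (multiplierGraph d α).sub_mem hg hk, by simpa using hφ, ?_, ?_⟩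
  · refine (ENNReal.pow_lt_pow_left_iff two_ne_zero).1 ?_
    simpa using le_add_self.trans_lt hlt
  · refine (ENNReal.pow_lt_pow_left_iff two_ne_zero).1 ?_
    rw [energy_eq_enorm_sq hk] at hlt
    simpa using le_self_add.trans_lt hlt

theorem mem_killedFormDomain_of_mem_formGraph {α : ℝ}
    {D : Set (EuclideanSpace ℝ (Fin d))} {p : L2 d × L2 d} (hp : p ∈ formGraph α D) :
    p.1 ∈ killedFormDomain α D := by
  have hpm := formGraph_le_multiplierGraph α D hp
  refine ⟨?_, fun ε hε => ?_⟩
  · change energy α p.1 < ⊤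
    rw [energy_eq_enorm_sq hpm]
    exact ENNReal.pow_lt_top enorm_lt_top
  · set δ := min 1 (ε / 2) with hδ
    have hδ0 : 0 < δ := lt_min one_pos (ENNReal.half_pos hε.ne')
    obtain ⟨q, hq, hqt, h1, h2⟩ := mem_formGraph_iff.1 hp δ hδ0
    refine ⟨q.1, hqt, ?_⟩
    have h3 := energy_eq_enorm_sq ((multiplierGraph d α).sub_mem hpm hq)
    simp only [Prod.fst_sub, Prod.snd_sub] at h3
    rw [h3]
    have hsq : ∀ x : ENNReal, x < δ → x ^ 2 < ε / 2 := fun x hx =>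
      (pow_le_of_le_one zero_le (hx.le.trans (min_le_left _ _)) two_ne_zero).trans_lt
        (hx.trans_le (min_le_right _ _))
    calc _ < ε / 2 + ε / 2 := ENNReal.add_lt_add (hsq _ h2) (hsq _ h1)
      _ = ε := ENNReal.add_halves ε

theorem vanishesOff_of_mem_formGraph {α : ℝ} {D : Set (EuclideanSpace ℝ (Fin d))}
    {p : L2 d × L2 d} (hp : p ∈ formGraph α D) : VanishesOff D p.1 := by
  obtain ⟨q, hq, hlim⟩ := mem_closure_iff_seq_limit.1 (show p ∈ closure _ from hp)
  have h1 : Tendsto (fun n => (q n).1) atTop (𝓝 p.1) :=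
    continuous_fst.continuousAt.tendsto.comp hlim
  obtain ⟨φ, -, hae⟩ := exists_ae_tendsto_subseq h1
  have hq' : ∀ᵐ x ∂volume, ∀ n, x ∉ D → (q n).1 x = 0 := by
    refine ae_all_iff.2 fun n => ?_
    obtain ⟨ψ, -, -, h3, h4⟩ := (hq n).2
    filter_upwards [h4] with x h5 hx
    rw [LinearMap.fst_apply] at h5
    rw [h5]
    exact image_eq_zero_of_notMem_tsupport fun h => hx (h3 h)
  filter_upwards [hae, hq'] with x h2 h3 hx
  refine tendsto_nhds_unique h2 ?_
  simp [h3 _ hx]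

/-! ### Test functions have finite energy and span infinitely many dimensions -/

theorem stableSymbol_le {α : ℝ} (hα : 0 < α) (hα2 : α ≤ 2) (ξ : EuclideanSpace ℝ (Fin d)) :
    stableSymbol α ξ ≤ 1 + (2 * Real.pi) ^ 2 * ‖ξ‖ ^ 2 := by
  unfold stableSymbol
  rw [← mul_pow]
  set x := 2 * Real.pi * ‖ξ‖ with hx
  have hx0 : 0 ≤ x := by positivity
  rcases le_total x 1 with h | h
  · have := Real.rpow_le_one hx0 h hα.le
    nlinarith [sq_nonneg x]
  · have := Real.rpow_le_rpow_of_exponent_le h hα2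
    rw [Real.rpow_two] at this
    linarith

theorem energy_toLp_lt_top {α : ℝ} (hα : 0 < α) (hα2 : α ≤ 2)
    (f : 𝓢(EuclideanSpace ℝ (Fin d), ℂ)) : energy α (f.toLp 2) < ⊤ := by
  obtain ⟨C, hC⟩ := (𝓕 f).decay 0 0
  simp only [pow_zero, one_mul, norm_iteratedFDeriv_zero] at hC
  have hC2 := hC.2
  have hint : Integrable (fun ξ => C * (‖(𝓕 f) ξ‖ +
      (2 * Real.pi) ^ 2 * (‖ξ‖ ^ 2 * ‖(𝓕 f) ξ‖))) volume :=
    (((𝓕 f).integrable.norm).add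
      ((SchwartzMap.integrable_pow_mul volume (𝓕 f) 2).const_mul _)).const_mul C
  refine lt_of_le_of_lt (lintegral_mono_ae ?_) hint.lintegral_lt_top
  rw [SchwartzMap.toLp_fourier_eq]
  filter_upwards [(𝓕 f).coeFn_toLp 2 volume] with ξ h
  rw [h, ← ofReal_norm, ← ENNReal.ofReal_pow (norm_nonneg _),
    ← ENNReal.ofReal_mul (stableSymbol_nonneg _ _)]
  refine ENNReal.ofReal_le_ofReal ?_
  calc stableSymbol α ξ * ‖(𝓕 f) ξ‖ ^ 2
      ≤ (1 + (2 * Real.pi) ^ 2 * ‖ξ‖ ^ 2) * (‖(𝓕 f) ξ‖ * C) := by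
        refine mul_le_mul (stableSymbol_le hα hα2 ξ) ?_ (by positivity) (by positivity)
        rw [sq]
        exact mul_le_mul_of_nonneg_left (hC2 ξ) (norm_nonneg _)
    _ = _ := by ring

theorem exists_mem_formGraph_of_testFunctions {α : ℝ} (hα : 0 < α) (hα2 : α ≤ 2)
    {D : Set (EuclideanSpace ℝ (Fin d))} {f : 𝓢(EuclideanSpace ℝ (Fin d), ℂ)}
    (hf : HasCompactSupport f) (hfD : tsupport f ⊆ D) :
    ∃ g, (f.toLp 2 volume, g) ∈ formGraph α D := by
  obtain ⟨g, hg⟩ := exists_mem_multiplierGraph hα (energy_toLp_lt_top hα hα2 f)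
  exact ⟨g, Submodule.le_topologicalClosure _ ⟨hg, f, f.smooth _, hf, hfD, f.coeFn_toLp 2 volume⟩⟩

/-- Bump functions at `n` distinct points of `D`, each equal to `1` at its own point and `0` at the
others, are independent by evaluation. The condition `1 ≤ d` makes a nonempty open set infinite. -/
theorem infiniteDimensional_formGraph {α : ℝ} (hα : 0 < α) (hα2 : α ≤ 2) (hd : 1 ≤ d)
    {D : Set (EuclideanSpace ℝ (Fin d))} (hD : IsOpen D) (hne : D.Nonempty) :
    FormGraph.InfiniteDimensional (formGraph α D) := by
  intro n
  obtain ⟨x₀, hx₀⟩ := hne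
  have : Nonempty (Fin d) := ⟨⟨0, hd⟩⟩
  have hinf : D.Infinite := infinite_of_mem_nhds x₀ (hD.mem_nhds hx₀)
  let x : Fin n → EuclideanSpace ℝ (Fin d) := fun j => hinf.natEmbedding D j
  have hxD : ∀ j, x j ∈ D := fun j => (hinf.natEmbedding D j).2
  have hxinj : Function.Injective x := fun j k h =>
    Fin.val_injective ((hinf.natEmbedding D).injective (Subtype.ext h))
  have hbump : ∀ j, ∃ f : 𝓢(EuclideanSpace ℝ (Fin d), ℂ), HasCompactSupport f ∧
      tsupport f ⊆ D \ (x '' {j}ᶜ) ∧ f (x j) = 1 := by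
    intro j
    have hopen : IsOpen (D \ (x '' {j}ᶜ)) := hD.sdiff (Set.toFinite _).isClosed
    have hmem : x j ∈ D \ (x '' {j}ᶜ) := by
      refine ⟨hxD j, ?_⟩
      rintro ⟨k, hk, h⟩
      exact hk (hxinj h)
    obtain ⟨f, h1, h2, h3, -, h4⟩ := exists_contDiff_tsupport_subset (n := ⊤) (hopen.mem_nhds hmem)
    have hc : HasCompactSupport (fun y => (f y : ℂ)) := h2.comp_left Complex.ofReal_zero
    have hs : ContDiff ℝ ∞ (fun y => (f y : ℂ)) := Complex.ofRealCLM.contDiff.comp h3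
    refine ⟨hc.toSchwartzMap hs, hc, ?_, by simp [h4]⟩
    exact (tsupport_comp_subset Complex.ofReal_zero f).trans h1
  choose f hfc hfs hf1 using hbump
  have hf0 : ∀ j k, j ≠ k → f j (x k) = 0 := fun j k hjk =>
    image_eq_zero_of_notMem_tsupport fun h => (hfs j h).2 ⟨k, fun h' => hjk h'.symm, rfl⟩
  choose g hg using fun j =>
    exists_mem_formGraph_of_testFunctions hα hα2 (hfc j) ((hfs j).trans Set.sdiff_subset)
  refine ⟨fun j => ((f j).toLp 2, g j), hg, Fintype.linearIndependent_iff.2 fun c hc k => ?_⟩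
  -- Values at points make no sense in `L2`, so the relation is first lifted to Schwartz functions.
  have hsum : ∑ j, c j • f j = 0 := by
    apply SchwartzMap.injective_toLp 2 volume
    have := map_sum (SchwartzMap.toLpCLM ℂ ℂ 2
      (volume : Measure (EuclideanSpace ℝ (Fin d)))) (fun j => c j • f j) Finset.univ
    simp only [map_smul, SchwartzMap.toLpCLM_apply] at this
    refine this.trans (hc.trans ?_)
    exact (map_zero (SchwartzMap.toLpCLM ℂ ℂ 2
      (volume : Measure (EuclideanSpace ℝ (Fin d))))).symm
  have := congrArg (fun F : 𝓢(EuclideanSpace ℝ (Fin d), ℂ) => F (x k)) hsum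
  simp only [sum_apply, smul_apply, zero_apply] at this
  rw [Finset.sum_eq_single k (fun j _ hj => by rw [hf0 j k hj, smul_zero]) (by simp)] at this
  simpa [hf1] using this

/-! ### Compactness of the embedding -/

/-- High frequencies are controlled by the energy. -/
theorem enorm_sq_le_setLIntegral_add {α R : ℝ} (hα : 0 < α) (hR : 0 < R) {p : L2 d × L2 d}
    (hp : p ∈ multiplierGraph d α) :
    ‖p.1‖ₑ ^ 2 ≤ (∫⁻ ξ in Metric.ball 0 R, ‖(𝓕 p.1 : L2 d) ξ‖ₑ ^ 2) +
      ENNReal.ofReal ((2 * Real.pi * R) ^ (-α)) * ‖p.2‖ₑ ^ 2 := by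
  rw [← energy_eq_enorm_sq hp, ← enorm_fourier, enorm_sq_eq_lintegral,
    ← lintegral_add_compl _ (Metric.isOpen_ball (x := (0 : EuclideanSpace ℝ (Fin d)))
      (ε := R)).measurableSet, energy, ← lintegral_const_mul' _ _ ENNReal.ofReal_ne_top]
  refine add_le_add le_rfl (le_trans (setLIntegral_mono' Metric.isOpen_ball.measurableSet.compl
    fun ξ hξ => ?_) (setLIntegral_le_lintegral _ _))
  rw [← mul_assoc, ← ENNReal.ofReal_mul (by positivity)]
  refine le_mul_of_one_le_left zero_le (ENNReal.one_le_ofReal.2 ?_)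
  have hξR : R ≤ ‖ξ‖ := by simpa using hξ
  rw [Real.rpow_neg (by positivity), ← div_eq_inv_mul, one_le_div (by positivity)]
  exact Real.rpow_le_rpow (by positivity) (by gcongr) hα.le

/-- Bounded sequences in a separable Hilbert space have weakly convergent subsequences. -/
theorem exists_subseq_tendsto_inner {H : Type*} [NormedAddCommGroup H] [InnerProductSpace ℂ H]
    [CompleteSpace H] [TopologicalSpace.SeparableSpace H] {u : ℕ → H} {C : ℝ}
    (hu : ∀ n, ‖u n‖ ≤ C) :
    ∃ φ : ℕ → ℕ, StrictMono φ ∧ ∀ v, ∃ z, Tendsto (fun n => inner ℂ v (u (φ n))) atTop (𝓝 z) := by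
  -- Sequential Banach–Alaoglu for the functionals `inner ℂ (u n) ·`; hence the conjugate in the
  -- limit below.
  obtain ⟨f, -, φ, hφ, hlim⟩ := WeakDual.isSeqCompact_closedBall ℂ H 0 C
    (x := fun n => StrongDual.toWeakDual (InnerProductSpace.toDual ℂ H (u n)))
    (fun n => by simpa using hu n)
  refine ⟨φ, hφ, fun v => ⟨starRingEnd ℂ (f v), ?_⟩⟩
  have h1 := ((WeakDual.eval_continuous v).tendsto f).comp hlim
  have h2 := (Complex.continuous_conj.tendsto _).comp h1
  refine h2.congr fun n => ?_
  simp [inner_conj_symm]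

/-- Rellich's theorem by frequency splitting. High frequencies of the differences are uniformly
small by the energy bound. At low frequencies the transforms converge pointwise along a weakly
convergent subsequence and are uniformly bounded, so dominated convergence on a ball applies. No
boundary regularity of `D` enters. -/
theorem compactEmbedding_formGraph {α : ℝ} (hα : 0 < α)
    {D : Set (EuclideanSpace ℝ (Fin d))} (hD : MeasurableSet D) (hfin : volume D < ⊤) :
    FormGraph.CompactEmbedding (formGraph α D) := by
  rintro p hp ⟨C, hC⟩
  have : Fact ((2 : ENNReal) ≠ ⊤) := ⟨by norm_num⟩
  obtain ⟨E, M, hEM, hE⟩ := exists_fourier_eq_inner hD hfin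
  obtain ⟨φ, hφ, hweak⟩ := exists_subseq_tendsto_inner (fun n => (hC n).1)
  refine ⟨φ, hφ, cauchySeq_tendsto_of_complete (EMetric.cauchySeq_iff.2 fun ε hε => ?_)⟩
  set B : ENNReal := ENNReal.ofReal (2 * C) ^ 2 with hB
  have hBtop : B ≠ ⊤ := ENNReal.pow_ne_top ENNReal.ofReal_ne_top
  have hdiff : ∀ a b : L2 d, ‖a‖ ≤ C → ‖b‖ ≤ C → ‖a - b‖ ≤ 2 * C := fun a b ha hb =>
    (norm_sub_le a b).trans (by linarith)
  have hε2 : 0 < ε ^ 2 / 2 := ENNReal.half_pos (ENNReal.pow_pos hε 2).ne'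
  -- `B` bounds the energy of every difference, so one radius serves the whole sequence.
  obtain ⟨R, hR0, hR⟩ : ∃ R : ℝ, 0 < R ∧
      ENNReal.ofReal ((2 * Real.pi * R) ^ (-α)) * B < ε ^ 2 / 2 := by
    have h1 : Tendsto (fun R : ℝ => ENNReal.ofReal ((2 * Real.pi * R) ^ (-α)) * B) atTop
        (𝓝 (ENNReal.ofReal 0 * B)) :=
      ENNReal.Tendsto.mul_const (ENNReal.tendsto_ofReal ((tendsto_rpow_neg_atTop hα).comp
        (tendsto_id.const_mul_atTop (by positivity)))) (Or.inr hBtop)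
    rw [ENNReal.ofReal_zero, zero_mul] at h1
    exact ((eventually_gt_atTop 0).and (h1.eventually (gt_mem_nhds hε2))).exists
  have hlow : Tendsto (fun ab : ℕ × ℕ => ∫⁻ ξ in Metric.ball 0 R,
      ‖(𝓕 ((p (φ ab.1)).1 - (p (φ ab.2)).1) : L2 d) ξ‖ₑ ^ 2) atTop (𝓝 0) := by
    have hae : ∀ᵐ ξ ∂(volume.restrict (Metric.ball (0 : EuclideanSpace ℝ (Fin d)) R)),
        ∀ ab : ℕ × ℕ, (𝓕 ((p (φ ab.1)).1 - (p (φ ab.2)).1) : L2 d) ξ =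
          inner ℂ (E ξ) ((p (φ ab.1)).1 - (p (φ ab.2)).1) :=
      ae_restrict_of_ae (ae_all_iff.2 fun ab => hE _ (vanishesOff_of_mem_formGraph
        ((formGraph α D).sub_mem (hp (φ ab.1)) (hp (φ ab.2)))))
    rw [← lintegral_zero (μ := volume.restrict (Metric.ball (0 : EuclideanSpace ℝ (Fin d)) R))]
    refine tendsto_lintegral_filter_of_dominated_convergence'
      (fun _ => ENNReal.ofReal (M * (2 * C)) ^ 2)
      (Eventually.of_forall fun ab => ((Lp.aestronglyMeasurable _).enorm.pow_const 2).restrict)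
      (Eventually.of_forall fun ab => ?_) ?_ ?_
    · filter_upwards [hae] with ξ h
      rw [h, ← ofReal_norm]
      gcongr
      exact (norm_inner_le_norm _ _).trans (mul_le_mul (hEM ξ) (hdiff _ _ (hC _).1 (hC _).1)
        (norm_nonneg _) ((norm_nonneg _).trans (hEM ξ)))
    · rw [lintegral_const]
      refine ENNReal.mul_ne_top (ENNReal.pow_ne_top ENNReal.ofReal_ne_top) ?_
      rw [Measure.restrict_apply_univ]
      exact measure_ball_lt_top.ne
    · filter_upwards [hae] with ξ h
      obtain ⟨z, hz⟩ := hweak (E ξ)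
      have h1 : Tendsto (fun ab : ℕ × ℕ => inner ℂ (E ξ) ((p (φ ab.1)).1 - (p (φ ab.2)).1))
          atTop (𝓝 (z - z)) := by
        simp only [inner_sub_right]
        rw [← prod_atTop_atTop_eq]
        exact (hz.comp tendsto_fst).sub (hz.comp tendsto_snd)
      rw [sub_self] at h1
      simp only [h]
      simpa [Function.comp_def] using (ENNReal.continuous_pow 2).continuousAt.tendsto.comp h1.enorm
  obtain ⟨⟨N₁, N₂⟩, hN⟩ := eventually_atTop.1 (hlow.eventually (gt_mem_nhds hε2))
  refine ⟨max N₁ N₂, fun m hm n hn => ?_⟩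
  have h1 := hN (m, n) ⟨(le_max_left _ _).trans hm, (le_max_right _ _).trans hn⟩
  have h2 := enorm_sq_le_setLIntegral_add hα hR0 (formGraph_le_multiplierGraph α D
    ((formGraph α D).sub_mem (hp (φ m)) (hp (φ n))))
  have h3 : ‖(p (φ m) - p (φ n)).2‖ₑ ^ 2 ≤ B := by
    rw [hB, ← ofReal_norm]
    gcongr
    exact hdiff _ _ (hC _).2 (hC _).2
  rw [edist_eq_enorm_sub]
  refine (ENNReal.pow_lt_pow_left_iff two_ne_zero).1 (h2.trans_lt ?_)
  calc _ < ε ^ 2 / 2 + ε ^ 2 / 2 :=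
        ENNReal.add_lt_add h1 ((mul_le_mul_right h3 _).trans_lt hR)
    _ = ε ^ 2 := ENNReal.add_halves _

/-! ### Transfer to the operator and comparison of the orders -/

theorem isEigenpair_iff {α : ℝ} (hα : 0 < α) {D : Set (EuclideanSpace ℝ (Fin d))} {μ : ℝ}
    {p : L2 d × L2 d} (hp : p ∈ formGraph α D) :
    FormGraph.IsEigenpair (formGraph α D) μ p ↔ (p.1, (μ : ℂ) • p.1) ∈ generatorGraph α D := by
  constructor
  · rintro ⟨-, h⟩
    refine ⟨mem_killedFormDomain_of_mem_formGraph (p := p) hp, ?_, fun v hv => ?_⟩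
    · filter_upwards [vanishesOff_of_mem_formGraph hp, Lp.coeFn_smul (μ : ℂ) p.1] with x h1 h2 hx
      rw [h2, Pi.smul_apply, h1 hx, smul_zero]
    · obtain ⟨g, hg⟩ := mem_formGraph_of_mem_killedFormDomain hα hv
      have := dirichletForm_eq_inner (formGraph_le_multiplierGraph α D hg)
        (formGraph_le_multiplierGraph α D hp)
      dsimp only at this ⊢
      rw [this, inner_smul_right]
      exact h _ hg
  · rintro ⟨-, -, h⟩
    refine ⟨hp, fun q hq => ?_⟩
    have h1 := h _ (mem_killedFormDomain_of_mem_formGraph hq)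
    rwa [dirichletForm_eq_inner (formGraph_le_multiplierGraph α D hq)
        (formGraph_le_multiplierGraph α D hp), inner_smul_right] at h1

theorem levels_eq {α : ℝ} (hα : 0 < α) (D : Set (EuclideanSpace ℝ (Fin d))) (i : ℕ) :
    levels α D i = FormGraph.levels (formGraph α D) i := by
  ext t
  constructor
  · rintro ⟨u, hli, hu⟩
    have hex : ∀ j, ∃ g, (u j, g) ∈ formGraph α D := fun j =>
      let ⟨_, _, hE⟩ := hu j
      mem_formGraph_of_mem_killedFormDomain hα hE.2.1
    choose g hg using hex
    refine ⟨fun j => (u j, g j), hli, fun j => ?_⟩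
    obtain ⟨μ, hμ, hE⟩ := hu j
    exact ⟨μ, hμ, (isEigenpair_iff hα (hg j)).2 hE.2⟩
  · rintro ⟨p, hli, hp⟩
    refine ⟨fun j => (p j).1, hli, fun j => ?_⟩
    obtain ⟨μ, hμ, hE⟩ := hp j
    exact ⟨μ, hμ, hli.ne_zero j, (isEigenpair_iff hα hE.1).1 hE⟩

/-- The interpolation inequality in the form used by min-max: a bound `m` on the quotient of order
`β` becomes `m ^ (α / β)` for order `α`. -/
theorem norm_snd_sq_le_rpow {α β : ℝ} (hα : 0 < α) (hαβ : α < β) {p q : L2 d × L2 d} {m : ℝ}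
    (hm : 0 ≤ m) (hp : p ∈ multiplierGraph d α) (hq : q ∈ multiplierGraph d β) (hpq : p.1 = q.1)
    (h : ‖q.2‖ ^ 2 ≤ m * ‖q.1‖ ^ 2) : ‖p.2‖ ^ 2 ≤ m ^ (α / β) * ‖p.1‖ ^ 2 := by
  have hβ : 0 < β := hα.trans hαβ
  have hθ : 0 ≤ α / β := by positivity
  have hθ1 : 0 ≤ 1 - α / β := sub_nonneg.2 ((div_lt_one hβ).2 hαβ).le
  have h1 := energy_le_rpow_mul_rpow hα hαβ p.1
  rw [energy_eq_enorm_sq hp, hpq, energy_eq_enorm_sq hq, ← ofReal_norm, ← ofReal_norm,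
    ← ofReal_norm, ← ENNReal.ofReal_pow (norm_nonneg _), ← ENNReal.ofReal_pow (norm_nonneg _),
    ← ENNReal.ofReal_pow (norm_nonneg _), ENNReal.ofReal_rpow_of_nonneg (by positivity) hθ,
    ENNReal.ofReal_rpow_of_nonneg (by positivity) hθ1, ← ENNReal.ofReal_mul (by positivity),
    ENNReal.ofReal_le_ofReal_iff (by positivity)] at h1
  rw [hpq]
  calc ‖p.2‖ ^ 2 ≤ (‖q.2‖ ^ 2) ^ (α / β) * (‖q.1‖ ^ 2) ^ (1 - α / β) := h1
    _ ≤ (m * ‖q.1‖ ^ 2) ^ (α / β) * (‖q.1‖ ^ 2) ^ (1 - α / β) := by gcongr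
    _ = m ^ (α / β) * ‖q.1‖ ^ 2 := by
      rw [Real.mul_rpow hm (by positivity), mul_assoc,
        ← Real.rpow_add_of_nonneg (by positivity) hθ hθ1, add_sub_cancel, Real.rpow_one]

end StableEig

theorem theorem1p2 (d : ℕ) (hd : 1 ≤ d) (D : Set (EuclideanSpace ℝ (Fin d)))
    (hDopen : IsOpen D) (hDconn : IsConnected D)
    (hDfin : MeasureTheory.volume D < ⊤)
    (α β : ℝ) (hα : 0 < α) (hαβ : α < β) (hβ : β ≤ 2) (i : ℕ) (hi : 1 ≤ i) :
    IsLeast (StableEig.levels α D i) (StableEig.stableEigenvalue α D i) ∧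
    IsLeast (StableEig.levels β D i) (StableEig.stableEigenvalue β D i) ∧
    StableEig.stableEigenvalue α D i ^ (1 / α) ≤ StableEig.stableEigenvalue β D i ^ (1 / β) := by
  obtain ⟨n, rfl⟩ : ∃ n, i = n + 1 := ⟨i - 1, by omega⟩
  have hβ0 : 0 < β := hα.trans hαβ
  obtain ⟨a, ha0, hal, -, hamin⟩ := FormGraph.exists_isLeast_levels
    (StableEig.isClosed_formGraph α D) (StableEig.compactEmbedding_formGraph hα hDopen.measurableSet hDfin)
    (StableEig.infiniteDimensional_formGraph hα (hαβ.le.trans hβ) hd hDopen hDconn.nonempty) n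
  obtain ⟨b, hb0, hbl, ⟨w, hw, hli, hwle⟩, -⟩ := FormGraph.exists_isLeast_levels
    (StableEig.isClosed_formGraph β D) (StableEig.compactEmbedding_formGraph hβ0 hDopen.measurableSet hDfin)
    (StableEig.infiniteDimensional_formGraph hβ0 hβ hd hDopen hDconn.nonempty) n
  rw [← StableEig.levels_eq hα] at hal
  rw [← StableEig.levels_eq hβ0] at hbl
  have hae : StableEig.stableEigenvalue α D (n + 1) = a := hal.csInf_eq
  have hbe : StableEig.stableEigenvalue β D (n + 1) = b := hbl.csInf_eq
  rw [hae, hbe]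
  refine ⟨hal, hbl, ?_⟩
  -- The optimal trial space for `β` is used for `α`: first components are kept, second components
  -- are replaced by the multiplier of order `α`.
  have hab : a ≤ b ^ (α / β) := by
    have hex : ∀ j, ∃ g, ((w j).1, g) ∈ StableEig.formGraph α D := fun j =>
      StableEig.mem_formGraph_of_mem_killedFormDomain hα (StableEig.killedFormDomain_anti hα hαβ D
        (StableEig.mem_killedFormDomain_of_mem_formGraph (hw j)))
    choose g hg using hex
    refine hamin _ (fun j => ((w j).1, g j)) hg hli fun c => ?_
    have e1 : (∑ j, c j • ((w j).1, g j)).1 = (∑ j, c j • w j).1 := by simp [Prod.fst_sum]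
    have h1 : ∑ j, c j • ((w j).1, g j) ∈ StableEig.formGraph α D :=
      Submodule.sum_mem _ fun j _ => Submodule.smul_mem _ (c j) (hg j)
    have h2 : ∑ j, c j • w j ∈ StableEig.formGraph β D :=
      Submodule.sum_mem _ fun j _ => Submodule.smul_mem _ (c j) (hw j)
    exact StableEig.norm_snd_sq_le_rpow hα hαβ hb0 (StableEig.formGraph_le_multiplierGraph α D h1)
      (StableEig.formGraph_le_multiplierGraph β D h2) e1 (hwle c)
  calc a ^ (1 / α) ≤ (b ^ (α / β)) ^ (1 / α) := Real.rpow_le_rpow ha0 hab (by positivity)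
    _ = b ^ (1 / β) := by rw [← Real.rpow_mul hb0]; congr 1; field_simp
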